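/- Let $(M,J)$ be a connected (Hausdorff, finite-dimensional, $C^\infty$) almost complex manifold, i.e. $J$ is a smooth field of endomorphisms of $TM$ with $J^2=-1$. A smooth map between almost complex manifolds is called pseudoholomorphic if its differential commutes with the almost complex structures. Let $\mathbb D\subset\mathbb C$ be the open unit disk with the Poincaré distance $$d(z,w)=\operatorname{artanh}\left|\frac{z-w}{1-\bar w z}\right|$$ induced by the metric $|dz|/(1-|z|^2)$. For $p,q\in M$ let $d_M(p,q)\in[0,\infty]$ be the infimum of $\sum_{k=1}^m d(z_k,w_k)$ over all $m\ge 1$, all pseudoholomorphic maps $f_1,\dots,f_m:\mathbb D\to M$ and all points $z_k,w_k\in\mathbb D$ with $f_1(z_1)=p$, $f_k(w_k)=f_{k+1}(z_{k+1})$ for $1\le k<m$, and $f_m(w_m)=q$ (with $d_M(p,q)=\infty$ if there are none). Suppose that $(M,J)$ is (Kobayashi) hyperbolic, i.e. $d_M(p,q)>0$ whenever $p\ne q$. Let $G$ be an almost complex Lie group of positive dimension, i.e. a (finite-dimensional real $C^\infty$) Lie group of positive dimension endowed with a smooth almost complex structure $J_G$; no invariance of $J_G$ under translations needs to be assumed.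 Then $G$ does not act effectively on $M$ as a pseudoholomorphic transformation group. That is, there is no group action $G\times M\to M$, $(g,p)\mapsto gp$, such that the action map is smooth, every $g\in G$ acts as a pseudoholomorphic map $M\to M$, every orbit map $G\to M$, $g\mapsto gp$ ($p\in M$), is pseudoholomorphic (equivalently to these three conditions: the action map is smooth and pseudoholomorphic for the product structure on $G\times M$), and only the identity of $G$ acts as the identity on $M$. -/

import Mathlib

open scoped Manifold ContDiff ENNReal

noncomputable section

/-- A smooth (`C^∞`) almost complex structure on the manifold `M` (without boundary, modelled on
the real normed space `E`): a smooth section `J` of the bundle `Hom(TM, TM)` with `J² = -1`. -/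
structure AlmostComplexStructure (E : Type*) [NormedAddCommGroup E] [NormedSpace ℝ E]
    (M : Type*) [TopologicalSpace M] [ChartedSpace E M] [IsManifold 𝓘(ℝ, E) ∞ M] where
  /-- The endomorphism of each tangent space. -/
  toFun : ∀ x : M, TangentSpace 𝓘(ℝ, E) x →L[ℝ] TangentSpace 𝓘(ℝ, E) x
  sq_eq_neg : ∀ (x : M) (v : TangentSpace 𝓘(ℝ, E) x), toFun x (toFun x v) = -v
  contMDiff : ContMDiff 𝓘(ℝ, E) (𝓘(ℝ, E).prod 𝓘(ℝ, E →L[ℝ] E)) ∞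
    (fun x ↦ Bundle.TotalSpace.mk' (E →L[ℝ] E)
      (E := fun x : M ↦ TangentSpace 𝓘(ℝ, E) x →L[ℝ] TangentSpace 𝓘(ℝ, E) x) x (toFun x))

namespace AlmostComplexStructure

variable {E : Type*} [NormedAddCommGroup E] [NormedSpace ℝ E]
  {M : Type*} [TopologicalSpace M] [ChartedSpace E M] [IsManifold 𝓘(ℝ, E) ∞ M]
  {F : Type*} [NormedAddCommGroup F] [NormedSpace ℝ F]
  {N : Type*} [TopologicalSpace N] [ChartedSpace F N] [IsManifold 𝓘(ℝ, F) ∞ N]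

/-- Multiplication by `i`, as a real-linear endomorphism of `ℂ`. -/
def mulI : ℂ →L[ℝ] ℂ := ContinuousLinearMap.mul ℝ ℂ Complex.I

/-- The standard (almost) complex structure of `ℂ`. -/
def standard : AlmostComplexStructure ℂ ℂ where
  toFun _ := mulI
  sq_eq_neg _ v := by
    have h : ∀ v : ℂ, Complex.I * (Complex.I * v) = -v := fun v ↦ by
      rw [← mul_assoc, Complex.I_mul_I, neg_one_mul]
    exact h v
  contMDiff := by
    intro x₀
    rw [contMDiffAt_hom_bundle]
    refine ⟨contMDiffAt_id, ?_⟩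
    have h : ContMDiffAt 𝓘(ℝ, ℂ) 𝓘(ℝ, ℂ →L[ℝ] ℂ) ∞
        (inTangentCoordinates 𝓘(ℝ, ℂ) 𝓘(ℝ, ℂ) id id (fun _ : ℂ ↦ mulI) x₀) x₀ := by
      rw [inTangentCoordinates_model_space]
      exact contMDiffAt_const
    exact h

/-- The map `f` is pseudoholomorphic on the open set `s`: it is smooth there and its differential
commutes with the almost complex structures. -/
def IsPseudoholomorphicOn (J : AlmostComplexStructure E M) (J' : AlmostComplexStructure F N)
    (f : M → N) (s : Set M) : Prop :=
  ContMDiffOn 𝓘(ℝ, E) 𝓘(ℝ, F) ∞ f s ∧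
    ∀ x ∈ s, ∀ v : TangentSpace 𝓘(ℝ, E) x,
      mfderiv 𝓘(ℝ, E) 𝓘(ℝ, F) f x (J.toFun x v) =
        J'.toFun (f x) (mfderiv 𝓘(ℝ, E) 𝓘(ℝ, F) f x v)

/-- The map `f` is pseudoholomorphic. -/
def IsPseudoholomorphic (J : AlmostComplexStructure E M) (J' : AlmostComplexStructure F N)
    (f : M → N) : Prop :=
  J.IsPseudoholomorphicOn J' f Set.univ

/-- The Poincaré distance on the open unit disk, i.e. the distance induced by the metric
`|dz| / (1 - |z|²)`. -/
def poincareDist (z w : ℂ) : ℝ :=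
  Real.artanh ‖(z - w) / (1 - (starRingEnd ℂ) w * z)‖

/-- A Kobayashi chain joining `p` to `q`: a nonempty finite sequence of pseudoholomorphic maps from
the open unit disk to `M`, with two points in each disk whose images link up from `p` to `q`.
(The disk maps are functions on `ℂ` of which only the restriction to the disk matters.) -/
structure KobayashiChain (J : AlmostComplexStructure E M) (p q : M) where
  /-- The number of disks, minus one. -/
  m : ℕ
  /-- The disks. -/
  f : Fin (m + 1) → ℂ → M
  /-- The initial points. -/
  z : Fin (m + 1) → ℂ
  /-- The final points. -/
  w : Fin (m + 1) → ℂ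
  isPseudoholomorphicOn : ∀ k, standard.IsPseudoholomorphicOn J (f k) (Metric.ball 0 1)
  z_mem : ∀ k, z k ∈ Metric.ball (0 : ℂ) 1
  w_mem : ∀ k, w k ∈ Metric.ball (0 : ℂ) 1
  start : f 0 (z 0) = p
  link : ∀ k : Fin m, f k.castSucc (w k.castSucc) = f k.succ (z k.succ)
  finish : f (Fin.last m) (w (Fin.last m)) = q

/-- The length of a Kobayashi chain. -/
def KobayashiChain.length {J : AlmostComplexStructure E M} {p q : M}
    (c : J.KobayashiChain p q) : ℝ :=
  ∑ k, poincareDist (c.z k) (c.w k)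

/-- The Kobayashi pseudodistance: the infimum of the lengths of the Kobayashi chains joining two
points, and `∞` if there is none. -/
def kobayashiDist (J : AlmostComplexStructure E M) (p q : M) : ℝ≥0∞ :=
  ⨅ c : J.KobayashiChain p q, ENNReal.ofReal c.length

/-- Kobayashi hyperbolicity: the Kobayashi pseudodistance is a distance, that is, it separates
points. -/
def IsHyperbolic (J : AlmostComplexStructure E M) : Prop :=
  ∀ p q : M, p ≠ q → 0 < J.kobayashiDist p q

/-- The smooth action of the Lie group `G`, carrying the almost complex structure `JG`, on the
almost complex manifold `(M, J)` is pseudoholomorphic: the action map `G × M → M` is smooth and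
pseudoholomorphic in each variable (that is, pseudoholomorphic for the product structure), so every
`g : G` acts by a pseudoholomorphic transformation of `M` and all orbit maps `g ↦ g • p` are
pseudoholomorphic. -/
structure IsPseudoholomorphicAction {G : Type*} [TopologicalSpace G] [ChartedSpace F G]
    [IsManifold 𝓘(ℝ, F) ∞ G] [Group G] [MulAction G M]
    (JG : AlmostComplexStructure F G) (J : AlmostComplexStructure E M) : Prop where
  contMDiff_smul : ContMDiff (𝓘(ℝ, F).prod 𝓘(ℝ, E)) 𝓘(ℝ, E) ∞ (fun a : G × M ↦ a.1 • a.2)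
  transformation : ∀ g : G, J.IsPseudoholomorphic J (fun p : M ↦ g • p)
  orbitMap : ∀ p : M, JG.IsPseudoholomorphic J (fun g : G ↦ g • p)

end AlmostComplexStructure

end

/-! Suppose `G` acts effectively and pick a nonzero `X` in the tangent space at `1`. Let `γ`, `δ` be
the one-parameter subgroups with velocities `X` and `JG X` (`exists_oneParameterSubgroup`). For
every `p` the map `z ↦ γ (re z) • δ (im z) • p` is an entire pseudoholomorphic curve
(`isPseudoholomorphic_orbit`). Indeed, with `q = δ (im z) • p`, its partial derivatives at `z` are
the images under the differential of `γ (re z)` of the velocities at `q` induced by `X` and `JG X`.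
The orbit map of `q` makes the second velocity `J` times the first, and the transformation `γ (re
z)` preserves this relation. Only the value of `JG` at `1` enters, so no invariance is needed. Disks
of arbitrarily large radius in such a curve force Kobayashi distance zero, so hyperbolicity makes it
constant (`eq_of_isPseudoholomorphic`). On the real axis this says that `γ s` fixes every `p`;
effectiveness gives `γ = 1`, hence `X = 0`. -/

section

open Set Filter Topology

/-! ### Smoothness of integral curves. -/

section IntegralCurve

variable {E : Type*} [NormedAddCommGroup E] [NormedSpace ℝ E]
  {M : Type*} [TopologicalSpace M] [ChartedSpace E M] [IsManifold 𝓘(ℝ, E) 1 M]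

/-- An integral curve of a `C^n` vector field is `C^n`. -/
theorem IsMIntegralCurveAt.contMDiffAt_nat [CompleteSpace E] {γ : ℝ → M} {v : (x : M) → TangentSpace 𝓘(ℝ, E) x}
    {t₀ : ℝ} {n : ℕ}
    (hv : ContMDiffAt 𝓘(ℝ, E) 𝓘(ℝ, E).tangent n
      (fun x ↦ (⟨x, v x⟩ : TangentBundle 𝓘(ℝ, E) M)) (γ t₀))
    (hγ : IsMIntegralCurveAt γ v t₀) : ContMDiffAt 𝓘(ℝ, ℝ) 𝓘(ℝ, E) n γ t₀ := by
  -- The field read in the chart at `γ t₀`; regularity then follows from the ODE theorem in `E`.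
  set v' : E → E := fun x ↦
    tangentCoordChange 𝓘(ℝ, E) ((extChartAt 𝓘(ℝ, E) (γ t₀)).symm x) (γ t₀)
      ((extChartAt 𝓘(ℝ, E) (γ t₀)).symm x) (v ((extChartAt 𝓘(ℝ, E) (γ t₀)).symm x)) with hv'
  rw [contMDiffAt_iff] at hv
  have hv₁ : ContDiffAt ℝ n v' (extChartAt 𝓘(ℝ, E) (γ t₀) (γ t₀)) :=
    (hv.2.contDiffAt (range_mem_nhds_isInteriorPoint
      BoundarylessManifold.isInteriorPoint)).snd
  obtain ⟨u, hu, hvu⟩ := hv₁.contDiffOn le_rfl (by simp)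
  have hc : ContinuousAt (extChartAt 𝓘(ℝ, E) (γ t₀) ∘ γ) t₀ :=
    (continuousAt_extChartAt (γ t₀)).comp hγ.continuousAt
  have hsrc : ∀ᶠ t in 𝓝 t₀, γ t ∈ (extChartAt 𝓘(ℝ, E) (γ t₀)).source :=
    hγ.continuousAt.preimage_mem_nhds (extChartAt_source_mem_nhds (γ t₀))
  have hder : ∀ᶠ t in 𝓝 t₀, HasDerivAt (extChartAt 𝓘(ℝ, E) (γ t₀) ∘ γ)
      (v' ((extChartAt 𝓘(ℝ, E) (γ t₀) ∘ γ) t)) t := by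
    filter_upwards [hsrc, hγ.eventually_hasDerivAt] with t ht₁ ht₂
    apply ht₂.congr_deriv
    simp only [hv', Function.comp_apply]
    rw [PartialEquiv.left_inv _ ht₁]
  obtain ⟨ε, hε, hball⟩ := Metric.eventually_nhds_iff_ball.1
    (hder.and (hc.preimage_mem_nhds hu))
  have hsub : Icc (t₀ - ε / 2) (t₀ + ε / 2) ⊆ Metric.ball t₀ ε := by
    rw [Real.ball_eq_Ioo]
    exact Icc_subset_Ioo (by linarith) (by linarith)
  have hcd : ContDiffOn ℝ (n : ℕ∞) (extChartAt 𝓘(ℝ, E) (γ t₀) ∘ γ)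
      (Icc (t₀ - ε / 2) (t₀ + ε / 2)) := by
    refine ODE.contDiffOn_enat_Icc_of_hasDerivWithinAt (f := fun _ ↦ v') (u := u) ?_ ?_ ?_
    · exact hvu.comp contDiff_snd.contDiffOn fun x hx ↦ hx.2
    · exact fun t ht ↦ (hball t (hsub ht)).1.hasDerivWithinAt
    · exact fun t ht ↦ (hball t (hsub ht)).2
  rw [contMDiffAt_iff_target]
  exact ⟨hγ.continuousAt, (hcd.contDiffAt (Icc_mem_nhds (by linarith) (by linarith))).contMDiffAt⟩

theorem IsMIntegralCurve.contMDiff_infty [CompleteSpace E] {γ : ℝ → M} {v : (x : M) → TangentSpace 𝓘(ℝ, E) x}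
    (hv : ContMDiff 𝓘(ℝ, E) 𝓘(ℝ, E).tangent ∞
      (fun x ↦ (⟨x, v x⟩ : TangentBundle 𝓘(ℝ, E) M)))
    (hγ : IsMIntegralCurve γ v) : ContMDiff 𝓘(ℝ, ℝ) 𝓘(ℝ, E) ∞ γ := by
  rw [_root_.contMDiff_infty]
  exact fun n t ↦ (hγ.isMIntegralCurveAt t).contMDiffAt_nat
    ((_root_.contMDiff_infty.1 hv n).contMDiffAt)

end IntegralCurve

/-! ### One-parameter subgroups of a Lie group. -/

section OneParameterSubgroup

theorem mulInvariantVectorField_one {F : Type*} [NormedAddCommGroup F] [NormedSpace ℝ F]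
    {G : Type*} [TopologicalSpace G] [ChartedSpace F G] [Group G]
    (X : GroupLieAlgebra 𝓘(ℝ, F) G) :
    mulInvariantVectorField X 1 = X := by
  have : (fun x : G ↦ 1 * x) = id := by ext x; simp
  rw [mulInvariantVectorField, this, mfderiv_id]
  rfl

variable {F : Type*} [NormedAddCommGroup F] [NormedSpace ℝ F]
  {G : Type*} [TopologicalSpace G] [ChartedSpace F G] [Group G] [LieGroup 𝓘(ℝ, F) ∞ G]

/-- The left-invariant vector fields of a smooth Lie group are smooth. -/
theorem contMDiff_infty_mulInvariantVectorField (X : GroupLieAlgebra 𝓘(ℝ, F) G) :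
    ContMDiff 𝓘(ℝ, F) 𝓘(ℝ, F).tangent ∞
      (fun g : G ↦ (mulInvariantVectorField X g : TangentBundle 𝓘(ℝ, F) G)) := by
  have hm : ContMDiff (𝓘(ℝ, F).prod 𝓘(ℝ, F)) 𝓘(ℝ, F) ∞ (fun p : G × G ↦ p.1 * p.2) :=
    contMDiff_mul 𝓘(ℝ, F) ∞
  have h₁ : ContMDiff 𝓘(ℝ, F) 𝓘(ℝ, F).tangent ∞
      (fun g : G ↦ (Bundle.TotalSpace.mk' F g 0 : TangentBundle 𝓘(ℝ, F) G)) :=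
    Bundle.contMDiff_zeroSection _ _
  have h₂ : ContMDiff 𝓘(ℝ, F) 𝓘(ℝ, F).tangent ∞
      (fun _ : G ↦ (Bundle.TotalSpace.mk' F 1 X : TangentBundle 𝓘(ℝ, F) G)) :=
    contMDiff_const
  have h₃ := hm.contMDiff_tangentMap (m := ∞) (by simp)
  -- The field is the tangent map of multiplication applied to `(0, X)` over `(g, 1)`.
  convert! (h₃.comp contMDiff_equivTangentBundleProd_symm).comp (h₁.prodMk h₂) with g
  · simp
  · simp only [Function.comp_apply, tangentMap]
    rw [mfderiv_prod_eq_add_apply (hm.mdifferentiable (by simp)).mdifferentiableAt]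
    simp +instances only [mulInvariantVectorField]
    refine (zero_add _).symm.trans ?_
    exact congrArg₂ (fun a b : F ↦ a + b) (ContinuousLinearMap.map_zero _).symm rfl

/-- Chain rule for the factorisation of translation by `g * h` into two translations. -/
theorem mfderiv_mul_left_mulInvariantVectorField (X : GroupLieAlgebra 𝓘(ℝ, F) G) (g h : G) :
    mfderiv 𝓘(ℝ, F) 𝓘(ℝ, F) (g * ·) h (mulInvariantVectorField X h) =
      mulInvariantVectorField X (g * h) := by
  have hd : ∀ a b : G, MDifferentiableAt 𝓘(ℝ, F) 𝓘(ℝ, F) (a * ·) b := fun a b ↦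
    ((contMDiff_mul_left (I := 𝓘(ℝ, F)) (n := ∞) (a := a)).mdifferentiable (by simp)) b
  have hcomp : (fun x : G ↦ g * h * x) = (g * ·) ∘ (h * ·) := by
    ext x; simp [mul_assoc]
  have hone : ∀ k : G, k = h → mfderiv 𝓘(ℝ, F) 𝓘(ℝ, F) (g * ·) k =
      mfderiv 𝓘(ℝ, F) 𝓘(ℝ, F) (g * ·) h := by rintro k rfl; rfl
  simp only [mulInvariantVectorField]
  rw [hcomp, mfderiv_comp (I' := 𝓘(ℝ, F)) _ (hd g _) (hd h 1)]
  exact congrArg (fun A : F →L[ℝ] F ↦ A (mfderiv 𝓘(ℝ, F) 𝓘(ℝ, F) (h * ·) 1 X))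
    (hone _ (mul_one h)).symm

theorem IsMIntegralCurveOn.mul_left {X : GroupLieAlgebra 𝓘(ℝ, F) G} {γ : ℝ → G} {s : Set ℝ}
    (hγ : IsMIntegralCurveOn γ (mulInvariantVectorField X) s) (g : G) :
    IsMIntegralCurveOn (fun t ↦ g * γ t) (mulInvariantVectorField X) s := by
  intro t ht
  have hd : HasMFDerivAt 𝓘(ℝ, F) 𝓘(ℝ, F) (g * ·) (γ t) _ :=
    ((contMDiff_mul_left (I := 𝓘(ℝ, F)) (n := ∞) (a := g)).mdifferentiable
      (by simp) (γ t)).hasMFDerivAt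
  refine (hd.comp_hasMFDerivWithinAt t (hγ t ht)).congr_mfderiv ?_
  have key : ∀ (A : F →L[ℝ] F) (w w' : F), A w = w' →
      A ∘L (1 : ℝ →L[ℝ] ℝ).smulRight w = (1 : ℝ →L[ℝ] ℝ).smulRight w' := by
    rintro A w _ rfl
    ext
    simp
  exact key _ _ _ (mfderiv_mul_left_mulInvariantVectorField X g (γ t))

/-- Every tangent vector at the identity of a Lie group is the initial velocity of a smooth
one-parameter subgroup. -/
theorem exists_oneParameterSubgroup [T2Space G] [CompleteSpace F]
    (X : GroupLieAlgebra 𝓘(ℝ, F) G) :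
    ∃ γ : ℝ → G, ContMDiff 𝓘(ℝ, ℝ) 𝓘(ℝ, F) ∞ γ ∧ γ 0 = 1 ∧ (∀ s t, γ (s + t) = γ s * γ t) ∧
      IsMIntegralCurve γ (mulInvariantVectorField X) := by
  have hv := contMDiff_infty_mulInvariantVectorField X
  have hv₁ : ContMDiff 𝓘(ℝ, F) 𝓘(ℝ, F).tangent 1
      (fun g : G ↦ (mulInvariantVectorField X g : TangentBundle 𝓘(ℝ, F) G)) :=
    hv.of_le (by simp)
  obtain ⟨γ₀, h₀, hγ₀⟩ := exists_isMIntegralCurveAt_of_contMDiffAt_boundaryless 0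
    (hv₁.contMDiffAt (x := (1 : G)))
  obtain ⟨ε, hε, hγ₀⟩ := isMIntegralCurveAt_iff'.1 hγ₀
  rw [Real.ball_eq_Ioo, zero_sub, zero_add] at hγ₀
  -- Left translates of `γ₀` give the same existence time `ε` at every point, so the field is
  -- complete.
  obtain ⟨γ, h1, hγ⟩ := exists_isMIntegralCurve_of_isMIntegralCurveOn hv₁ hε
    (fun g ↦ ⟨fun t ↦ g * γ₀ t, by simp [h₀], hγ₀.mul_left g⟩) 1
  refine ⟨γ, hγ.contMDiff_infty hv, h1, fun s t ↦ ?_, hγ⟩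
  -- As functions of `t`, both sides are integral curves with value `γ s` at `0`.
  have h := isMIntegralCurve_Ioo_eq_of_contMDiff_boundaryless (t₀ := 0) hv₁ (hγ.comp_add s)
    (isMIntegralCurve_iff_isMIntegralCurveOn.2 ((hγ.isMIntegralCurveOn univ).mul_left (γ s)))
    (by simp [h1])
  simpa [add_comm] using congrFun h t

end OneParameterSubgroup

/-! ### Entire curves in hyperbolic manifolds. -/

namespace AlmostComplexStructure

variable {E : Type*} [NormedAddCommGroup E] [NormedSpace ℝ E]
  {M : Type*} [TopologicalSpace M] [ChartedSpace E M] [IsManifold 𝓘(ℝ, E) ∞ M]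

theorem IsPseudoholomorphic.comp_mul {J : AlmostComplexStructure E M} {f : ℂ → M}
    (hf : standard.IsPseudoholomorphic J f) (c : ℂ) :
    standard.IsPseudoholomorphic J (fun z ↦ f (c * z)) := by
  have hmul : ContMDiff 𝓘(ℝ, ℂ) 𝓘(ℝ, ℂ) ∞ (fun z : ℂ ↦ c * z) :=
    (contDiff_const.mul contDiff_id).contMDiff
  have hfd := contMDiffOn_univ.1 hf.1
  refine ⟨contMDiffOn_univ.2 (hfd.comp hmul), fun z _ (v : ℂ) ↦ ?_⟩
  have hd : HasMFDerivAt 𝓘(ℝ, ℂ) 𝓘(ℝ, ℂ) (fun z : ℂ ↦ c * z) z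
      (ContinuousLinearMap.mul ℝ ℂ c) :=
    (ContinuousLinearMap.mul ℝ ℂ c).hasFDerivAt.hasMFDerivAt
  have h := ((hfd.mdifferentiable (by simp) (c * z)).hasMFDerivAt.comp z hd).mfderiv
  have key : ∀ w : ℂ, mfderiv 𝓘(ℝ, ℂ) 𝓘(ℝ, E) (fun z ↦ f (c * z)) z w =
      (mfderiv 𝓘(ℝ, ℂ) 𝓘(ℝ, E) f (c * z) (c * w : ℂ) : E) := fun w ↦
    congrArg (fun A : ℂ →L[ℝ] E ↦ A w) h
  have hJ := hf.2 (c * z) (mem_univ _) (c * v : ℂ)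
  refine (key _).trans (Eq.trans ?_ (hJ.trans ?_))
  · exact congrArg (fun w : ℂ ↦ (mfderiv 𝓘(ℝ, ℂ) 𝓘(ℝ, E) f (c * z) w : E))
      (mul_left_comm c Complex.I v)
  · exact congrArg (fun w : E ↦ (J.toFun (f (c * z)) w : E)) (key v).symm

theorem poincareDist_zero_left (w : ℂ) : poincareDist 0 w = Real.artanh ‖w‖ := by
  simp [poincareDist]

/-- The points on a pseudoholomorphic entire curve have Kobayashi pseudodistance zero. -/
theorem IsPseudoholomorphic.kobayashiDist_eq_zero {J : AlmostComplexStructure E M} {f : ℂ → M}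
    (hf : standard.IsPseudoholomorphic J f) (ζ : ℂ) : J.kobayashiDist (f 0) (f ζ) = 0 := by
  have hlim : Tendsto (fun n : ℕ ↦ ENNReal.ofReal (Real.artanh ‖ζ / n‖)) atTop (𝓝 0) := by
    have h₁ : Tendsto (fun n : ℕ ↦ ‖ζ / n‖) atTop (𝓝 0) := by
      simpa using (tendsto_const_div_atTop_nhds_zero_nat ζ).norm
    have h₂ : ContinuousAt Real.artanh 0 := by
      unfold Real.artanh
      fun_prop (disch := norm_num)
    have h₃ := ENNReal.tendsto_ofReal (h₂.tendsto.comp h₁)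
    simpa using h₃
  have hle : ∀ᶠ n : ℕ in atTop,
      J.kobayashiDist (f 0) (f ζ) ≤ ENNReal.ofReal (Real.artanh ‖ζ / n‖) := by
    obtain ⟨N, hN⟩ := exists_nat_gt ‖ζ‖
    filter_upwards [eventually_ge_atTop N] with n hn
    have hn' : ‖ζ‖ < n := hN.trans_le (by exact_mod_cast hn)
    have hn₀ : (0 : ℝ) < n := (norm_nonneg ζ).trans_lt hn'
    have hnc : (n : ℂ) ≠ 0 := by
      exact_mod_cast hn₀.ne'
    -- A single disk, since `m` is the number of disks minus one: `f` on the disk of radius `n`,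
    -- rescaled.
    let c : J.KobayashiChain (f 0) (f ζ) :=
      { m := 0
        f := fun _ z ↦ f (n * z)
        z := fun _ ↦ 0
        w := fun _ ↦ ζ / n
        isPseudoholomorphicOn := fun _ ↦
          ⟨(hf.comp_mul n).1.mono (subset_univ _), fun x _ ↦ (hf.comp_mul n).2 x (mem_univ _)⟩
        z_mem := fun _ ↦ by simp
        w_mem := fun _ ↦ by
          rw [mem_ball_zero_iff, norm_div, Complex.norm_natCast, div_lt_one hn₀]
          exact hn'
        start := by simp
        link := fun k ↦ k.elim0
        finish := by rw [mul_div_cancel₀ _ hnc] }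
    have hc : c.length = Real.artanh ‖ζ / n‖ := by
      simp only [KobayashiChain.length, c, poincareDist_zero_left, Finset.sum_const]
      simp
    exact (iInf_le _ c).trans_eq (by rw [hc])
  exact le_antisymm (ge_of_tendsto hlim hle) bot_le

/-- A hyperbolic almost complex manifold is Brody hyperbolic. -/
theorem IsHyperbolic.eq_of_isPseudoholomorphic {J : AlmostComplexStructure E M}
    (hJ : J.IsHyperbolic) {f : ℂ → M} (hf : standard.IsPseudoholomorphic J f) (ζ : ℂ) :
    f 0 = f ζ := by
  by_contra h
  exact (hJ _ _ h).ne' (hf.kobayashiDist_eq_zero ζ)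

/-- A smooth map from `ℂ` whose partial derivatives satisfy `∂f/∂y = J ∂f/∂x` is
pseudoholomorphic. -/
theorem isPseudoholomorphic_of_partial {J : AlmostComplexStructure E M} {f : ℂ → M}
    (hf : ContMDiff 𝓘(ℝ, ℂ) 𝓘(ℝ, E) ∞ f)
    (h : ∀ z, mfderiv 𝓘(ℝ, ℂ) 𝓘(ℝ, E) f z Complex.I =
      J.toFun (f z) (mfderiv 𝓘(ℝ, ℂ) 𝓘(ℝ, E) f z (1 : ℂ))) :
    standard.IsPseudoholomorphic J f := by
  refine ⟨contMDiffOn_univ.2 hf, fun z _ v ↦ ?_⟩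
  have key : ∀ (D : ℂ →L[ℝ] E) (A : E →L[ℝ] E), (∀ w, A (A w) = -w) →
      D Complex.I = A (D 1) → ∀ v : ℂ, D (Complex.I * v) = A (D v) := by
    intro D A hA hD v
    have hv : v = v.re • (1 : ℂ) + v.im • Complex.I := by
      apply Complex.ext <;> simp
    have hIv : Complex.I * v = v.re • Complex.I + v.im • (-1 : ℂ) := by
      apply Complex.ext <;> simp
    rw [hIv, hv]
    simp only [map_add, map_smul, map_neg, hD, hA]
    simp
  exact key _ _ (J.sq_eq_neg (f z)) (h z) v

end AlmostComplexStructure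

/-! ### Entire curves from a pseudoholomorphic action. -/

namespace AlmostComplexStructure

variable {E : Type*} [NormedAddCommGroup E] [NormedSpace ℝ E]
  {M : Type*} [TopologicalSpace M] [ChartedSpace E M] [IsManifold 𝓘(ℝ, E) ∞ M]
  {F : Type*} [NormedAddCommGroup F] [NormedSpace ℝ F]
  {G : Type*} [TopologicalSpace G] [ChartedSpace F G]
  [Group G] [LieGroup 𝓘(ℝ, F) ∞ G] [MulAction G M]

namespace IsPseudoholomorphicAction

variable {JG : AlmostComplexStructure F G} {J : AlmostComplexStructure E M}

/-- The velocity at time `0` of the orbit of `q` under a one-parameter subgroup. -/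
theorem hasMFDerivAt_orbit (h : IsPseudoholomorphicAction JG J) {X : GroupLieAlgebra 𝓘(ℝ, F) G}
    {γ : ℝ → G} (h0 : γ 0 = 1) (hγ : IsMIntegralCurve γ (mulInvariantVectorField X)) (q : M) :
    HasMFDerivAt 𝓘(ℝ, ℝ) 𝓘(ℝ, E) (fun t ↦ γ t • q) 0
      ((1 : ℝ →L[ℝ] ℝ).smulRight
        (mfderiv 𝓘(ℝ, F) 𝓘(ℝ, E) (fun g : G ↦ g • q) 1 X : E)) := by
  have ho : MDifferentiable 𝓘(ℝ, F) 𝓘(ℝ, E) (fun g : G ↦ g • q) :=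
    (contMDiffOn_univ.1 (h.orbitMap q).1).mdifferentiable (by simp)
  refine ((ho (γ 0)).hasMFDerivAt.comp 0 (hγ 0)).congr_mfderiv ?_
  have hX : ∀ g : G, g = 1 → (mulInvariantVectorField X g : F) = X := by
    rintro g rfl
    exact mulInvariantVectorField_one X
  have hD : ∀ g : G, g = 1 → (mfderiv 𝓘(ℝ, F) 𝓘(ℝ, E) (fun g : G ↦ g • q) g : F →L[ℝ] E) =
      mfderiv 𝓘(ℝ, F) 𝓘(ℝ, E) (fun g : G ↦ g • q) 1 := by
    rintro g rfl
    rfl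
  have key : ∀ (A B : F →L[ℝ] E) (w w' : F), A = B → w = w' →
      A ∘L (1 : ℝ →L[ℝ] ℝ).smulRight w = (1 : ℝ →L[ℝ] ℝ).smulRight (B w') := by
    rintro A _ w _ rfl rfl
    ext
    simp
  exact key _ _ _ _ (hD _ h0) (hX _ h0)

/-- The orbit maps of the product of two one-parameter subgroups whose initial velocities
are `X` and `JX` are pseudoholomorphic. -/
theorem isPseudoholomorphic_orbit (h : IsPseudoholomorphicAction JG J)
    {X : GroupLieAlgebra 𝓘(ℝ, F) G} {γ δ : ℝ → G}
    (hγs : ContMDiff 𝓘(ℝ, ℝ) 𝓘(ℝ, F) ∞ γ) (hγ0 : γ 0 = 1)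
    (hγadd : ∀ s t, γ (s + t) = γ s * γ t)
    (hγ : IsMIntegralCurve γ (mulInvariantVectorField X))
    (hδs : ContMDiff 𝓘(ℝ, ℝ) 𝓘(ℝ, F) ∞ δ) (hδ0 : δ 0 = 1)
    (hδadd : ∀ s t, δ (s + t) = δ s * δ t)
    (hδ : IsMIntegralCurve δ (mulInvariantVectorField (JG.toFun 1 X))) (p : M) :
    standard.IsPseudoholomorphic J (fun z : ℂ ↦ γ z.re • δ z.im • p) := by
  have hre : ContMDiff 𝓘(ℝ, ℂ) 𝓘(ℝ, ℝ) ∞ Complex.re := Complex.reCLM.contDiff.contMDiff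
  have him : ContMDiff 𝓘(ℝ, ℂ) 𝓘(ℝ, ℝ) ∞ Complex.im := Complex.imCLM.contDiff.contMDiff
  have hsm : ContMDiff 𝓘(ℝ, ℂ) 𝓘(ℝ, E) ∞ (fun z : ℂ ↦ γ z.re • δ z.im • p) :=
    h.contMDiff_smul.comp ((hγs.comp hre).prodMk
      (h.contMDiff_smul.comp ((hδs.comp him).prodMk contMDiff_const)))
  refine isPseudoholomorphic_of_partial hsm fun z ↦ ?_
  have hfz := (hsm.mdifferentiable (by simp) z).hasMFDerivAt
  set q : M := δ z.im • p with hq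
  have htd := contMDiffOn_univ.1 (h.transformation (γ z.re)).1
  have htr := (htd.mdifferentiable (by simp) q).hasMFDerivAt
  -- the derivative of `f` along the line `t ↦ z + t * c`, computed in two ways
  have hline : ∀ (c : ℂ) (η : ℝ → G) (Y : GroupLieAlgebra 𝓘(ℝ, F) G), η 0 = 1 →
      IsMIntegralCurve η (mulInvariantVectorField Y) →
      (∀ t : ℝ, γ (z + t * c).re • δ (z + t * c).im • p = γ z.re • η t • q) →
      (mfderiv 𝓘(ℝ, ℂ) 𝓘(ℝ, E) (fun z : ℂ ↦ γ z.re • δ z.im • p) z c : E) =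
        (mfderiv 𝓘(ℝ, E) 𝓘(ℝ, E) (fun x : M ↦ γ z.re • x) q
          (mfderiv 𝓘(ℝ, F) 𝓘(ℝ, E) (fun g : G ↦ g • q) 1 Y : E) : E) := by
    intro c η Y hη0 hη hc
    have hl : HasMFDerivAt 𝓘(ℝ, ℝ) 𝓘(ℝ, ℂ) (fun t : ℝ ↦ z + t * c) 0
        ((1 : ℝ →L[ℝ] ℝ).smulRight c) := by
      have : HasDerivAt (fun t : ℝ ↦ z + t * c) c 0 := by
        simpa using ((Complex.ofRealCLM.hasDerivAt (x := 0)).mul_const c).const_add z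
      exact this.hasFDerivAt.hasMFDerivAt
    have hz0 : z + ((0 : ℝ) : ℂ) * c = z := by simp
    have h₁ := HasMFDerivAt.comp (0 : ℝ) (g := fun z : ℂ ↦ γ z.re • δ z.im • p)
      (f := fun t : ℝ ↦ z + t * c) (by rw [hz0]; exact hfz) hl
    have hη0q : η 0 • q = q := by rw [hη0, one_smul]
    have h₂ := HasMFDerivAt.comp (0 : ℝ) (g := fun x : M ↦ γ z.re • x)
      (f := fun t : ℝ ↦ η t • q) (by rw [hη0q]; exact htr) (h.hasMFDerivAt_orbit hη0 hη q)
    have h₁₂ := hasMFDerivAt_unique h₁ (h₂.congr_of_eventuallyEq (Eventually.of_forall hc))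
    have h₃ := congrArg (fun A : ℝ →L[ℝ] E ↦ A 1) h₁₂
    have key₁ : ∀ (A : ℂ →L[ℝ] E) (v : ℂ),
        (A ∘L (1 : ℝ →L[ℝ] ℝ).smulRight v) 1 = A v := fun _ _ ↦ by simp
    have key₂ : ∀ (A : E →L[ℝ] E) (v : E),
        (A ∘L (1 : ℝ →L[ℝ] ℝ).smulRight v) 1 = A v := fun _ _ ↦ by simp
    exact (key₁ _ c).symm.trans (h₃.trans (key₂ _ _))
  have hx := hline 1 γ X hγ0 hγ fun t ↦ by simp [hγadd, mul_smul, hq]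
  -- Commuting the summands puts the increment `δ t` to the left of `δ z.im`, so that it acts on
  -- `q`.
  have hy := hline Complex.I δ (JG.toFun 1 X) hδ0 hδ fun t ↦ by
    simp [add_comm z.im, hδadd, mul_smul, hq]
  have ho : (mfderiv 𝓘(ℝ, F) 𝓘(ℝ, E) (fun g : G ↦ g • q) 1 (JG.toFun 1 X) : E) =
      J.toFun q (mfderiv 𝓘(ℝ, F) 𝓘(ℝ, E) (fun g : G ↦ g • q) 1 X : E) := by
    have hJ : ∀ (q' : M) (w : E), q' = q → (J.toFun q' w : E) = J.toFun q w := by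
      rintro q' w rfl
      rfl
    exact ((h.orbitMap q).2 1 (mem_univ _) X).trans (hJ _ _ (one_smul G q))
  refine hy.trans ?_
  rw [ho]
  refine ((h.transformation (γ z.re)).2 q (mem_univ _) _).trans ?_
  exact congrArg (fun w : E ↦ (J.toFun (γ z.re • q) w : E)) hx.symm

end IsPseudoholomorphicAction

end AlmostComplexStructure

end

theorem proposition3
    {E : Type*} [NormedAddCommGroup E] [NormedSpace ℝ E] [FiniteDimensional ℝ E]
    {M : Type*} [TopologicalSpace M] [T2Space M] [ConnectedSpace M]
    [ChartedSpace E M] [IsManifold 𝓘(ℝ, E) ∞ M]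
    (J : AlmostComplexStructure E M) (hJ : J.IsHyperbolic)
    {F : Type*} [NormedAddCommGroup F] [NormedSpace ℝ F] [FiniteDimensional ℝ F]
    {G : Type*} [TopologicalSpace G] [T2Space G] [ChartedSpace F G]
    [Group G] [LieGroup 𝓘(ℝ, F) ∞ G]
    (JG : AlmostComplexStructure F G) (hdim : 0 < Module.finrank ℝ F) :
    ¬ ∃ _ : MulAction G M,
        FaithfulSMul G M ∧ AlmostComplexStructure.IsPseudoholomorphicAction JG J := by
  rintro ⟨_, _, h⟩
  have : CompleteSpace F := FiniteDimensional.complete ℝ F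
  have : Nontrivial F := Module.finrank_pos_iff.1 hdim
  obtain ⟨X, hX⟩ := exists_ne (0 : F)
  obtain ⟨γ, hγs, hγ0, hγadd, hγ⟩ :=
    exists_oneParameterSubgroup (G := G) (X : GroupLieAlgebra 𝓘(ℝ, F) G)
  obtain ⟨δ, hδs, hδ0, hδadd, hδ⟩ := exists_oneParameterSubgroup (G := G) (JG.toFun 1 X)
  have hγ1 : γ = fun _ ↦ 1 := by
    funext s
    refine FaithfulSMul.eq_of_smul_eq_smul (α := M) fun p ↦ ?_
    -- At real `s` the factor from `δ` is `δ 0 = 1`.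
    have := hJ.eq_of_isPseudoholomorphic
      (h.isPseudoholomorphic_orbit hγs hγ0 hγadd hγ hδs hδ0 hδadd hδ p) (s : ℂ)
    simpa [hγ0, hδ0] using this.symm
  subst hγ1
  -- The constant curve has velocity zero, but as an integral curve it has velocity `X` at time `0`.
  have h₁ := hasMFDerivAt_unique (hγ 0) (hasMFDerivAt_const (1 : G) (0 : ℝ))
  have key : ∀ w : F, ((1 : ℝ →L[ℝ] ℝ).smulRight w) 1 = w := fun w ↦ by simp
  have h₂ : (mulInvariantVectorField (I := 𝓘(ℝ, F)) (G := G) X 1 : F) = 0 :=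
    (key _).symm.trans (congrArg (fun A : ℝ →L[ℝ] F ↦ A 1) h₁)
  exact hX ((mulInvariantVectorField_one (F := F) (G := G) X).symm.trans h₂)
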